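/- An $n\times n$ alternating sign matrix (ASM) is a matrix $B=(b_{i,j})_{1\le i,j\le n}$ with entries in $\{-1,0,1\}$ such that every row sum and every column sum equals $1$ and all partial sums $\sum_{j=1}^k b_{i,j}$ and $\sum_{i=1}^k b_{i,j}$ lie in $\{0,1\}$. For an ASM $B$ let $$\mathrm{Inv}(B)=\sum_{1\le i<j\le n}\ \sum_{1\le k<\ell\le n} b_{i,\ell}\,b_{j,k},$$ let $N(B)$ be the number of entries of $B$ equal to $-1$, and let $t(B)$ be the number of $0$ entries to the left of the unique $1$ in the top row of $B$. For elements $x,y,z$ of a commutative ring $R$ (for instance complex numbers, or indeterminates) define $$Z_{ASM}^{(n)}(x,y,z)=\sum_{B\ n\times n\ \mathrm{ASM}} z^{t(B)}\,y^{\mathrm{Inv}(B)-N(B)}\,x^{N(B)} .$$ Let $x,y,\nu\in R$, where $\nu$ is any solution of $$x\,\nu(1-\nu)=\nu+y(1-\nu).$$ Let $G=(G_{i,j})_{i,j\ge 0}$ be the infinite matrix with generating function $$\sum_{i,j\ge 0}G_{i,j}u^iv^j=\frac{1}{1-xu-v-(y-x)uv}$$ (as a formal power series in $u,v$), and let $M=(1-\nu)\mathbb{I}+\nu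 G$. Then $M$ has generating function $$\sum_{i,j\ge 0}M_{i,j}u^iv^j=\frac{1-\nu}{1-uv}+\frac{\nu}{1-xu-v-(y-x)uv},$$ and for every $n\ge 0$ $$Z_{ASM}^{(n)}(x,y,1)=\det\bigl(M_{i,j}\bigr)_{0\le i,j\le n-1}.$$ -/

import Mathlib

open scoped Matrix

namespace ASM

/-- An `n × n` alternating sign matrix: entries in `{-1, 0, 1}`, all row and column sums equal
to `1`, and all partial row and column sums equal to `0` or `1`. -/
structure IsASM {n : ℕ} (B : Matrix (Fin n) (Fin n) ℤ) : Prop where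
  entry : ∀ i j, B i j = -1 ∨ B i j = 0 ∨ B i j = 1
  row_sum : ∀ i, ∑ j, B i j = 1
  col_sum : ∀ j, ∑ i, B i j = 1
  row_partial : ∀ i k, 0 ≤ ∑ j ∈ Finset.Iic k, B i j ∧ ∑ j ∈ Finset.Iic k, B i j ≤ 1
  col_partial : ∀ j k, 0 ≤ ∑ i ∈ Finset.Iic k, B i j ∧ ∑ i ∈ Finset.Iic k, B i j ≤ 1

open Classical in
/-- The finite set of all `n × n` alternating sign matrices (see `mem_asmFinset`). -/
noncomputable def asmFinset (n : ℕ) : Finset (Matrix (Fin n) (Fin n) ℤ) :=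
  (Fintype.piFinset fun _ : Fin n => Fintype.piFinset fun _ : Fin n =>
    ({-1, 0, 1} : Finset ℤ)).filter fun B => IsASM (n := n) B

theorem mem_asmFinset {n : ℕ} (B : Matrix (Fin n) (Fin n) ℤ) :
    B ∈ asmFinset n ↔ IsASM B := by
  classical
  unfold asmFinset
  refine Finset.mem_filter.trans ⟨fun h => h.2, fun h => ⟨?_, h⟩⟩
  refine Fintype.mem_piFinset.2 fun i => Fintype.mem_piFinset.2 fun j => ?_
  simpa using h.entry i j

/-- The inversion number `∑_{i < j, k < l} b_{i,l} b_{j,k}`. -/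
def inv {n : ℕ} (B : Matrix (Fin n) (Fin n) ℤ) : ℤ :=
  ∑ i, ∑ j ∈ Finset.Ioi i, ∑ k, ∑ l ∈ Finset.Ioi k, B i l * B j k

/-- The number of entries equal to `-1`. -/
def numNeg {n : ℕ} (B : Matrix (Fin n) (Fin n) ℤ) : ℕ :=
  (Finset.univ.filter fun p : Fin n × Fin n => B p.1 p.2 = -1).card

open Classical in
/-- The number of `0` entries to the left of the `1` in the top row. -/
noncomputable def topZeros {n : ℕ} (B : Matrix (Fin n) (Fin n) ℤ) : ℕ :=
  (Finset.univ.filter fun j : Fin n =>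
    ∃ i : Fin n, i.val = 0 ∧ B i j = 0 ∧ ∃ l, j < l ∧ B i l = 1).card

/-- `N(B) = (1/2) (-n + ∑ |b_{i,j}|)`. -/
theorem two_mul_numNeg {n : ℕ} {B : Matrix (Fin n) (Fin n) ℤ} (hB : IsASM B) :
    2 * (numNeg B : ℤ) = -n + ∑ i, ∑ j, |B i j| := by
  have h1 : ∑ i, ∑ j, |B i j| =
      ∑ i, ∑ j, (B i j + 2 * (if B i j = -1 then 1 else 0)) := by
    refine Finset.sum_congr rfl fun i _ => Finset.sum_congr rfl fun j _ => ?_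
    rcases hB.entry i j with h | h | h <;> simp [h]
  have h2 : (numNeg B : ℤ) = ∑ i, ∑ j, (if B i j = -1 then 1 else 0) := by
    rw [← Fintype.sum_prod_type' (f := fun i j => if B i j = -1 then (1 : ℤ) else 0)]
    simp [numNeg]
  rw [h1, h2]
  simp only [Finset.sum_add_distrib, ← Finset.mul_sum, hB.row_sum]
  simp

/-- `N(B) ≤ Inv(B)`, so that `Inv(B) - N(B)` is a genuine exponent. -/
theorem numNeg_le_inv {n : ℕ} {B : Matrix (Fin n) (Fin n) ℤ} (hB : IsASM B) :
    (numNeg B : ℤ) ≤ inv B := by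
  have h2 : (numNeg B : ℤ) = ∑ j, ∑ l, (if B j l = -1 then 1 else 0) := by
    rw [← Fintype.sum_prod_type' (f := fun i j => if B i j = -1 then (1 : ℤ) else 0)]
    simp [numNeg]
  have h3 : inv B = ∑ j, ∑ l, (∑ i ∈ Finset.Iio j, B i l) * (∑ k ∈ Finset.Iio l, B j k) := by
    unfold inv
    rw [Finset.sum_comm' (t' := Finset.univ) (s' := fun j => Finset.Iio j) (by simp)]
    refine Finset.sum_congr rfl fun j _ => ?_
    simp only [Finset.sum_mul_sum]
    calc ∑ i ∈ Finset.Iio j, ∑ k, ∑ l ∈ Finset.Ioi k, B i l * B j k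
        = ∑ i ∈ Finset.Iio j, ∑ l, ∑ k ∈ Finset.Iio l, B i l * B j k :=
          Finset.sum_congr rfl fun i _ =>
            Finset.sum_comm' (by simp)
      _ = ∑ l, ∑ i ∈ Finset.Iio j, ∑ k ∈ Finset.Iio l, B i l * B j k := Finset.sum_comm
  have key : ∀ (m : ℕ) (f : Fin m → ℤ) (a : Fin m),
      ∑ i ∈ Finset.Iic a, f i = f a + ∑ i ∈ Finset.Iio a, f i := by
    intro m f a
    rw [← Finset.Iio_insert, Finset.sum_insert (by simp)]
  have key2 : ∀ (m : ℕ) (f : Fin m → ℤ) (a : Fin m),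
      (∀ k, 0 ≤ ∑ i ∈ Finset.Iic k, f i) → 0 ≤ ∑ i ∈ Finset.Iio a, f i := by
    intro m f a h
    obtain ⟨a, ha⟩ := a
    cases a with
    | zero =>
      refine le_of_eq (Finset.sum_eq_zero fun i hi => ?_).symm
      simp [Fin.lt_def] at hi
    | succ b =>
      have : Finset.Iio (⟨b + 1, ha⟩ : Fin m) = Finset.Iic ⟨b, by omega⟩ := by
        ext i
        simp [Fin.lt_def, Fin.le_def]
      rw [this]
      exact h _
  rw [h2, h3]
  refine Finset.sum_le_sum fun j _ => Finset.sum_le_sum fun l _ => ?_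
  have hC := key2 n (fun i => B i l) j fun k => (hB.col_partial l k).1
  have hR := key2 n (fun k => B j k) l fun k => (hB.row_partial j k).1
  have hC' := (hB.col_partial l j).1
  have hR' := (hB.row_partial j l).1
  rw [key n (fun i => B i l) j] at hC'
  rw [key n (fun k => B j k) l] at hR'
  split_ifs with h
  · simp only [h] at hC' hR'
    nlinarith
  · exact mul_nonneg hC hR

/-- The partition function `∑_B z^{t(B)} y^{Inv(B) - N(B)} x^{N(B)}` over all `n × n`
alternating sign matrices; the exponent `Inv(B) - N(B)` is nonnegative by `numNeg_le_inv`. -/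
noncomputable def Z {R : Type*} [CommRing R] (n : ℕ) (x y z : R) : R :=
  ∑ B ∈ asmFinset n, z ^ topZeros B * y ^ (inv B - numNeg B).toNat * x ^ numNeg B

/-- The generating function `∑_{i,j ≥ 0} a_{i,j} u^i v^j` of an infinite matrix, as a formal
power series in the two variables `u = X 0` and `v = X 1`. -/
def genFun {R : Type*} [CommRing R] (A : Matrix ℕ ℕ R) : MvPowerSeries (Fin 2) R :=
  fun d => A (d 0) (d 1)

/-- The formal power series `1 / f`, for `f` with constant coefficient `1`
(see `mul_recip`). -/
noncomputable def recip {R : Type*} [CommRing R] (f : MvPowerSeries (Fin 2) R) :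
    MvPowerSeries (Fin 2) R :=
  MvPowerSeries.invOfUnit f 1

theorem mul_recip {R : Type*} [CommRing R] (f : MvPowerSeries (Fin 2) R)
    (hf : MvPowerSeries.constantCoeff f = 1) : f * recip f = 1 :=
  MvPowerSeries.mul_invOfUnit f 1 (by simpa using hf)

/-- The power series variable `u`, marking the row index. -/
noncomputable def u (R : Type*) [CommRing R] : MvPowerSeries (Fin 2) R := MvPowerSeries.X 0

/-- The power series variable `v`, marking the column index. -/
noncomputable def v (R : Type*) [CommRing R] : MvPowerSeries (Fin 2) R := MvPowerSeries.X 1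

/-- The denominator `1 - x u - v - (y - x) u v`. -/
noncomputable def denomG {R : Type*} [CommRing R] (x y : R) : MvPowerSeries (Fin 2) R :=
  1 - MvPowerSeries.C x * u R - v R - MvPowerSeries.C (y - x) * (u R * v R)

theorem constantCoeff_denomG {R : Type*} [CommRing R] (x y : R) :
    MvPowerSeries.constantCoeff (denomG x y) = 1 := by
  simp [denomG, u, v]

theorem constantCoeff_one_sub_uv (R : Type*) [CommRing R] :
    MvPowerSeries.constantCoeff (1 - u R * v R) = 1 := by
  simp [u, v]

/-- The infinite matrix `G` whose entry `(i, j)` is the coefficient of `u^i v^j` in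
`1 / (1 - x u - v - (y - x) u v)`. -/
noncomputable def G {R : Type*} [CommRing R] (x y : R) : Matrix ℕ ℕ R :=
  Matrix.of fun i j =>
    MvPowerSeries.coeff (Finsupp.single 0 i + Finsupp.single 1 j) (recip (denomG x y))

/-- The infinite matrix `(1 - ν) I + ν G`. -/
noncomputable def M {R : Type*} [CommRing R] (x y ν : R) : Matrix ℕ ℕ R :=
  (1 - ν) • (1 : Matrix ℕ ℕ R) + ν • G x y

/-- The truncation of an infinite matrix to its first `n` rows and columns. -/
def truncate {R : Type*} (n : ℕ) (A : Matrix ℕ ℕ R) : Matrix (Fin n) (Fin n) R :=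
  A.submatrix (fun i => (i : ℕ)) (fun j => (j : ℕ))

end ASM

/-! Recording the partial column and row sums of an alternating sign matrix as 0/1 edge states turns
it into a six-vertex configuration with domain wall boundary. Both statistics become products of
local weights, so the enumeration is an entry of a product of transfer matrices
(`Z_eq_partitionFn`).

Put `w = 1 - ν`. The equation for `ν` says precisely that `1 + x * ν - y` is inverse to `w`. Such a
`w` allows the weights to be deformed by a parameter `u_i` per row and `v_j` per column so that the
Yang–Baxter equation holds (`stack_mul_crossOp`). Hence the partition function is symmetric in the
`u_i`. Symmetry, a degree bound in one `v_j` and a recursion at `u_0 v_0 = 1` determine it by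
interpolation, which gives the Izergin–Korepin determinant (`izerginKorepin`).

After rescaling, that determinant has entries `(1 - w x u_i)(1 - w v_j) / pairWeight`. On the curve
this is exactly the generating function of `M` in the variables `u_i, v_j` (`mul_genFun_M`). So the
determinant of these series is the two Vandermonde determinants times the partition function times a
series with constant term 1. The coefficient of `∏ u_i^i ∏ v_j^j` is the truncated determinant of
`M` on one side and the partition function at `u = v = 0` on the other (`partitionFn_zero_eq_det`).
-/

namespace ASM

/-! ### Rows of the six-vertex model and commuting transfer matrices. -/

/-- The local operator of the six-vertex model: `s` and `t` are the states of the vertical edges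
above and below a vertex, the row and column indices are the states of the horizontal edges to its
left and right. The states are the partial column and row sums of the alternating sign matrix. -/
def localOp {S : Type*} [Zero S] (b₀ b₁ a c₁ c₂ : S) :
    Bool → Bool → Matrix Bool Bool S
  | false, false, false, false => b₀
  | true, true, true, true => b₁
  | true, true, false, false => a
  | false, false, true, true => a
  | false, true, false, true => c₁
  | true, false, true, false => c₂
  | _, _, _, _ => 0

/-- The ordered product of the local operators along a row, for given states `s` above and `t`
below the row. -/
def rowOp {S : Type*} [Semiring S] {n : ℕ} (L : Fin n → Bool → Bool → Matrix Bool Bool S)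
    (s t : Fin n → Bool) : Matrix Bool Bool S :=
  (List.ofFn fun j => L j (s j) (t j)).prod

/-- The row-to-row transfer matrix with horizontal boundary states `0` and `1`. -/
def transfer {S : Type*} [Semiring S] {n : ℕ} (L : Fin n → Bool → Bool → Matrix Bool Bool S) :
    Matrix (Fin n → Bool) (Fin n → Bool) S :=
  Matrix.of fun s t => rowOp L s t false true

theorem rowOp_cons {S : Type*} [Semiring S] {n : ℕ}
    (L : Fin (n + 1) → Bool → Bool → Matrix Bool Bool S) (a b : Bool) (s t : Fin n → Bool) :
    rowOp L (Fin.cons a s : Fin (n + 1) → Bool) (Fin.cons b t : Fin (n + 1) → Bool) =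
      L 0 a b * rowOp (fun j => L j.succ) s t := by
  simp [rowOp, List.ofFn_succ]

/-- Two vertically adjacent local operators, summed over the state of the edge between them. -/
def stack {S : Type*} [Semiring S] (L L' : Bool → Bool → Matrix Bool Bool S) (s t : Bool) :
    Matrix (Bool × Bool) (Bool × Bool) S :=
  Matrix.of fun p q => ∑ m, L s m p.1 q.1 * L' m t p.2 q.2

theorem sum_fin_succ_pi {A : Type*} [AddCommMonoid A] {n : ℕ} (f : (Fin (n + 1) → Bool) → A) :
    ∑ s, f s = ∑ a : Bool, ∑ s : Fin n → Bool, f (Fin.cons a s : Fin (n + 1) → Bool) := by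
  rw [← Fintype.sum_prod_type' (f := fun a s => f (Fin.cons a s : Fin (n + 1) → Bool))]
  exact (Fintype.sum_equiv (Fin.consEquiv fun _ => Bool) _ _ fun _ => rfl).symm

/-- Two adjacent rows interact only through the vertical edge in each column, so the sum over
intermediate states factors column by column. In this form an intertwiner can be pushed through the
two rows. -/
theorem sum_rowOp_mul_rowOp {S : Type*} [CommSemiring S] {n : ℕ}
    (L L' : Fin n → Bool → Bool → Matrix Bool Bool S) (s t : Fin n → Bool) (a a' b b' : Bool) :
    ∑ m, rowOp L s m a b * rowOp L' m t a' b' =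
      (List.ofFn fun j => stack (L j) (L' j) (s j) (t j)).prod (a, a') (b, b') := by
  induction n generalizing a a' with
  | zero =>
    simp only [rowOp, Matrix.one_apply, Prod.ext_iff, List.ofFn_zero, List.prod_nil]
    split_ifs <;> simp_all
  | succ n ih =>
    cases s using Fin.consCases with | _ s₀ s =>
    cases t using Fin.consCases with | _ t₀ t =>
    simp only [List.ofFn_succ, List.prod_cons, Fin.cons_zero, Fin.cons_succ, Matrix.mul_apply,
      sum_fin_succ_pi, rowOp_cons, Fintype.sum_prod_type, ← ih]
    simp only [stack, Matrix.of_apply, Finset.mul_sum, Finset.sum_mul]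
    simp only [Fintype.sum_bool, ← Finset.sum_add_distrib]
    exact Finset.sum_congr rfl fun m _ => by ring

theorem intertwine_ofFn {S ι : Type*} [Semiring S] [Fintype ι] [DecidableEq ι] {n : ℕ}
    (K K' : Fin n → Matrix ι ι S) (Q : Matrix ι ι S) (h : ∀ j, K j * Q = Q * K' j) :
    (List.ofFn K).prod * Q = Q * (List.ofFn K').prod := by
  induction n with
  | zero => simp
  | succ n ih =>
    simp only [List.ofFn_succ, List.prod_cons]
    rw [Matrix.mul_assoc, ih _ _ fun j => h j.succ, ← Matrix.mul_assoc, h, Matrix.mul_assoc]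

/-- Transfer matrices commute if their local operators are intertwined by a matrix whose corner
rows and columns are the same invertible multiple of the identity. -/
theorem transfer_commute_of_intertwine {S : Type*} [Field S] {n : ℕ}
    (L L' : Fin n → Bool → Bool → Matrix Bool Bool S)
    (Q : Matrix (Bool × Bool) (Bool × Bool) S)
    (h : ∀ j s t, stack (L j) (L' j) s t * Q = Q * stack (L' j) (L j) s t) (A : S) (hA : A ≠ 0)
    (hrow : ∀ p, Q (false, false) p = if p = (false, false) then A else 0)
    (hcol : ∀ p, Q p (true, true) = if p = (true, true) then A else 0) :
    transfer L * transfer L' = transfer L' * transfer L := by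
  ext s t
  simp only [Matrix.mul_apply, transfer, Matrix.of_apply, sum_rowOp_mul_rowOp]
  -- The left boundary `(0,0)` and the right boundary `(1,1)` are eigenvectors of `Q` for the same
  -- eigenvalue `A`, so this entry of the intertwining relation is `A` times the wanted identity.
  have key := congrFun (congrFun (intertwine_ofFn _ _ Q fun j => h j (s j) (t j)) (false, false))
    (true, true)
  rw [Matrix.mul_apply, Matrix.mul_apply] at key
  simp only [hrow, hcol, mul_ite, ite_mul, mul_zero, zero_mul, Finset.sum_ite_eq',
    Finset.mem_univ, if_true] at key
  rw [mul_comm] at key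
  exact mul_left_cancel₀ hA key

/-! ### Spectral parameters and the Yang–Baxter equation. -/

/-- The local operators with spectral parameters `u` (row) and `v` (column); `wi` stands for the
inverse of `w`. For `u = v = 0` the weights are `1, y, 1, 1, x`. -/
def spectralOp {S : Type*} [CommRing S] (x y w wi u v : S) : Bool → Bool → Matrix Bool Bool S :=
  localOp (1 - u * v) (y * (1 - u * v)) (1 - x * u - v - (y - x) * (u * v))
    ((1 - w * x * u) * (1 - w * v)) ((1 - wi * u) * (x - wi * v))

/-- The matrix intertwining two rows. -/
def crossOp {S : Type*} [CommRing S] (x y w wi u u' : S) :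
    Matrix (Bool × Bool) (Bool × Bool) S :=
  Matrix.of fun p q => match p, q with
    | (false, false), (false, false) => (1 - w * x * u) * (1 - wi * u') + (w * x - 1) * (u - u')
    | (true, true), (true, true) => (1 - w * x * u) * (1 - wi * u') + (w * x - 1) * (u - u')
    | (false, true), (false, true) => (1 - w * x * u) * (1 - wi * u')
    | (true, false), (true, false) => (1 - w * x * u') * (1 - wi * u)
    | (false, true), (true, false) => -y * (u - u')
    | (true, false), (false, true) => -(u - u')
    | _, _ => 0

/-- The Yang–Baxter equation. -/
theorem stack_mul_crossOp {K : Type*} [Field K] (x w u u' v : K) (hw : w ≠ 0) (s t : Bool) :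
    stack (spectralOp x (1 + x * (1 - w) - w⁻¹) w w⁻¹ u v)
        (spectralOp x (1 + x * (1 - w) - w⁻¹) w w⁻¹ u' v) s t *
      crossOp x (1 + x * (1 - w) - w⁻¹) w w⁻¹ u u' =
    crossOp x (1 + x * (1 - w) - w⁻¹) w w⁻¹ u u' *
      stack (spectralOp x (1 + x * (1 - w) - w⁻¹) w w⁻¹ u' v)
        (spectralOp x (1 + x * (1 - w) - w⁻¹) w w⁻¹ u v) s t := by
  ext ⟨a, b⟩ ⟨c, d⟩
  simp only [Matrix.mul_apply, Fintype.sum_prod_type, Fintype.sum_bool, stack, Matrix.of_apply]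
  cases s <;> cases t <;> cases a <;> cases b <;> cases c <;> cases d <;>
    simp only [crossOp, spectralOp, localOp, Matrix.of_apply, mul_zero, zero_mul, add_zero,
      zero_add] <;> field_simp <;> ring

/-- The transfer matrix of a row with spectral parameter `u`. -/
def spectralTransfer {S : Type*} [CommRing S] (x y w wi : S) {n : ℕ} (v : Fin n → S) (u : S) :
    Matrix (Fin n → Bool) (Fin n → Bool) S :=
  transfer fun j => spectralOp x y w wi u (v j)

/-- The inhomogeneous partition function with domain wall boundary conditions. -/
def partitionFn {S : Type*} [CommRing S] (x y w wi : S) {m n : ℕ} (u : Fin m → S)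
    (v : Fin n → S) : S :=
  (List.ofFn fun i => spectralTransfer x y w wi v (u i)).prod (fun _ => false) (fun _ => true)

theorem spectralTransfer_commute {K : Type*} [Field K] (x w : K) (hw : w ≠ 0) {n : ℕ}
    (v : Fin n → K) (u u' : K)
    (hA : (1 - w * x * u) * (1 - w⁻¹ * u') + (w * x - 1) * (u - u') ≠ 0) :
    Commute (spectralTransfer x (1 + x * (1 - w) - w⁻¹) w w⁻¹ v u)
      (spectralTransfer x (1 + x * (1 - w) - w⁻¹) w w⁻¹ v u') := by
  refine transfer_commute_of_intertwine _ _ (crossOp x (1 + x * (1 - w) - w⁻¹) w w⁻¹ u u')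
    (fun j s t => stack_mul_crossOp x w u u' (v j) hw s t) _ hA ?_ ?_
  · rintro ⟨_ | _, _ | _⟩ <;> simp [crossOp]
  · rintro ⟨_ | _, _ | _⟩ <;> simp [crossOp]

theorem partitionFn_comp_perm {K : Type*} [Field K] (x w : K) (hw : w ≠ 0) {m n : ℕ}
    (u : Fin m → K) (v : Fin n → K)
    (hA : ∀ i j, (1 - w * x * u i) * (1 - w⁻¹ * u j) + (w * x - 1) * (u i - u j) ≠ 0)
    (σ : Equiv.Perm (Fin m)) :
    partitionFn x (1 + x * (1 - w) - w⁻¹) w w⁻¹ (u ∘ σ) v =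
      partitionFn x (1 + x * (1 - w) - w⁻¹) w w⁻¹ u v := by
  unfold partitionFn
  refine congrArg
    (fun T : Matrix (Fin n → Bool) (Fin n → Bool) K => T (fun _ => false) (fun _ => true))
    (List.Perm.prod_eq' (Equiv.Perm.ofFn_comp_perm σ
      fun i => spectralTransfer x (1 + x * (1 - w) - w⁻¹) w w⁻¹ v (u i)) ?_)
  refine List.pairwise_ofFn.2 fun i j _ => ?_
  exact spectralTransfer_commute x w hw v _ _ (hA _ _)

theorem const_eq_cons {n : ℕ} (b : Bool) :
    (fun _ => b : Fin (n + 1) → Bool) = (Fin.cons b fun _ => b : Fin (n + 1) → Bool) := by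
  funext i
  cases i using Fin.cases <;> rfl

/-! ### Splitting off the first column. -/

section FirstColumn

variable {S : Type*} [CommRing S] (x y w wi : S) {n : ℕ} (v₀ : S) (v : Fin n → S)

theorem spectralTransfer_false_false (u : S) (s t : Fin n → Bool) :
    spectralTransfer x y w wi (Fin.cons v₀ v : Fin (n + 1) → S) u
        (Fin.cons false s : Fin (n + 1) → Bool) (Fin.cons false t : Fin (n + 1) → Bool) =
      (1 - u * v₀) * spectralTransfer x y w wi v u s t := by
  simp [spectralTransfer, transfer, rowOp_cons, Matrix.mul_apply, spectralOp, localOp]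

theorem spectralTransfer_false_true (u : S) (s t : Fin n → Bool) :
    spectralTransfer x y w wi (Fin.cons v₀ v : Fin (n + 1) → S) u
        (Fin.cons false s : Fin (n + 1) → Bool) (Fin.cons true t : Fin (n + 1) → Bool) =
      (1 - w * x * u) * (1 - w * v₀) *
        rowOp (fun j => spectralOp x y w wi u (v j)) s t true true := by
  simp [spectralTransfer, transfer, rowOp_cons, Matrix.mul_apply, spectralOp, localOp]

theorem spectralTransfer_true_true (u : S) (s t : Fin n → Bool) :
    spectralTransfer x y w wi (Fin.cons v₀ v : Fin (n + 1) → S) u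
        (Fin.cons true s : Fin (n + 1) → Bool) (Fin.cons true t : Fin (n + 1) → Bool) =
      (1 - x * u - v₀ - (y - x) * (u * v₀)) * spectralTransfer x y w wi v u s t := by
  simp [spectralTransfer, transfer, rowOp_cons, Matrix.mul_apply, spectralOp, localOp]

/-- The left boundary state is 0, and returning from 1 to 0 vertically would need an incoming 1. So
a first column that has reached state 1 keeps it. -/
theorem spectralTransfer_true_false (u : S) (s t : Fin n → Bool) :
    spectralTransfer x y w wi (Fin.cons v₀ v : Fin (n + 1) → S) u
        (Fin.cons true s : Fin (n + 1) → Bool) (Fin.cons false t : Fin (n + 1) → Bool) = 0 := by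
  simp [spectralTransfer, transfer, rowOp_cons, Matrix.mul_apply, spectralOp, localOp]

theorem prod_spectralTransfer_true_true {m : ℕ} (u : Fin m → S) (s t : Fin n → Bool) :
    (List.ofFn fun i =>
        spectralTransfer x y w wi (Fin.cons v₀ v : Fin (n + 1) → S) (u i)).prod
        (Fin.cons true s : Fin (n + 1) → Bool) (Fin.cons true t : Fin (n + 1) → Bool) =
      (∏ i, (1 - x * u i - v₀ - (y - x) * (u i * v₀))) *
        (List.ofFn fun i => spectralTransfer x y w wi v (u i)).prod s t := by
  induction m generalizing s with
  | zero => simp [Matrix.one_apply]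
  | succ m ih =>
    simp only [List.ofFn_succ, List.prod_cons, Matrix.mul_apply, sum_fin_succ_pi,
      Fintype.sum_bool, spectralTransfer_true_false, spectralTransfer_true_true, ih, zero_mul,
      Finset.sum_const_zero, add_zero, Fin.prod_univ_succ, Finset.mul_sum]
    exact Finset.sum_congr rfl fun r _ => by ring

/-- A horizontal 1 meeting a vertical 0 can only continue straight, so the whole row is forced. -/
theorem rowOp_const_false (u : S) (t : Fin n → Bool) (r : Bool) :
    rowOp (fun j => spectralOp x y w wi u (v j)) (fun _ => false) t true r =
      if t = (fun _ => false) ∧ r = true then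
        ∏ j, (1 - x * u - v j - (y - x) * (u * v j)) else 0 := by
  induction n with
  | zero =>
    have ht : t = fun _ => false := Subsingleton.elim _ _
    cases r <;> simp [rowOp, ht]
  | succ n ih =>
    cases t using Fin.consCases with | _ t₀ t =>
    rw [const_eq_cons, rowOp_cons, Matrix.mul_apply, Fin.prod_univ_succ]
    simp only [Fintype.sum_bool, ih (fun j => v j.succ), Fin.cons_inj]
    cases t₀ <;> simp [spectralOp, localOp]

/-- If the weight of the empty top left corner vanishes, the first row and column freeze. -/
theorem partitionFn_cons_cons {m : ℕ} (u₀ : S) (u : Fin m → S) (h : u₀ * v₀ = 1) :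
    partitionFn x y w wi (Fin.cons u₀ u : Fin (m + 1) → S) (Fin.cons v₀ v : Fin (n + 1) → S) =
      (1 - w * x * u₀) * (1 - w * v₀) * (∏ j, (1 - x * u₀ - v j - (y - x) * (u₀ * v j))) *
        (∏ i, (1 - x * u i - v₀ - (y - x) * (u i * v₀))) * partitionFn x y w wi u v := by
  unfold partitionFn
  rw [const_eq_cons false, const_eq_cons true]
  simp only [List.ofFn_succ, List.prod_cons, Matrix.mul_apply, sum_fin_succ_pi, Fin.cons_zero,
    Fin.cons_succ, Fintype.sum_bool, spectralTransfer_false_false, spectralTransfer_false_true,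
    prod_spectralTransfer_true_true, h, sub_self, zero_mul, Finset.sum_const_zero, add_zero,
    rowOp_const_false, and_true, mul_ite, ite_mul, mul_zero, Finset.sum_ite_eq', Finset.mem_univ,
    if_true]
  ring

end FirstColumn

/-! ### Degree in the first column parameter. -/

section Degree

open Polynomial

variable {K : Type*} [CommRing K] (x y w wi : K) {n : ℕ} (v : Fin n → K)

theorem mem_degreeLT_succ_of_natDegree_le {P : K[X]} {d : ℕ} (h : P.natDegree ≤ d) :
    P ∈ degreeLT K (d + 1) :=
  mem_degreeLT.2 ((degree_le_of_natDegree_le h).trans_lt (by exact_mod_cast Nat.lt_succ_self d))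

theorem mul_mem_degreeLT_add {P Q : K[X]} {d e : ℕ} (hP : P.natDegree ≤ d)
    (hQ : Q ∈ degreeLT K e) : P * Q ∈ degreeLT K (e + d) := by
  rcases eq_or_ne Q 0 with rfl | h0
  · simp
  · rw [mem_degreeLT, ← natDegree_lt_iff_degree_lt h0] at hQ
    rw [mem_degreeLT]
    refine degree_le_natDegree.trans_lt ?_
    have := natDegree_mul_le_of_le hP le_rfl (q := Q)
    exact_mod_cast (by omega : (P * Q).natDegree < e + d)

/-- The first column switches from 0 to 1 exactly once. The switching vertex supplies the factor `1
- w * v₀`, and each of the other `m - 1` vertices is of degree at most 1 in `v₀`. -/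
theorem exists_polynomial_false_true {m : ℕ} (u : Fin m → K) (s t : Fin n → Bool) :
    ∃ P ∈ degreeLT K m, ∀ v₀, (List.ofFn fun i =>
        spectralTransfer x y w wi (Fin.cons v₀ v : Fin (n + 1) → K) (u i)).prod
        (Fin.cons false s : Fin (n + 1) → Bool) (Fin.cons true t : Fin (n + 1) → Bool) =
      (1 - w * v₀) * P.eval v₀ := by
  induction m generalizing s with
  | zero => exact ⟨0, by simp, by simp⟩
  | succ m ih =>
    choose P hP hPe using fun s => ih (fun i => u i.succ) s
    -- The first sum collects the configurations switching in row 0, the second those switching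
    -- later.
    refine ⟨∑ r, ((1 - w * x * u 0) *
        rowOp (fun j => spectralOp x y w wi (u 0) (v j)) s r true true *
        (List.ofFn fun i => spectralTransfer x y w wi v (u (Fin.succ i))).prod r t) •
          ∏ i : Fin m, (C (1 - x * u i.succ) + C (-(1 + (y - x) * u i.succ)) * X) +
      ∑ r, spectralTransfer x y w wi v (u 0) s r • ((1 - C (u 0) * X) * P r), ?_, fun v₀ => ?_⟩
    · refine add_mem (sum_mem fun r _ => Submodule.smul_mem _ _ ?_)
        (sum_mem fun r _ => Submodule.smul_mem _ _ ?_)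
      · refine mem_degreeLT_succ_of_natDegree_le ((natDegree_prod_le _ _).trans ?_)
        refine (Finset.sum_le_card_nsmul _ _ 1 fun i _ => ?_).trans (by simp)
        compute_degree
      · exact mul_mem_degreeLT_add (by compute_degree) (hP r)
    · simp only [List.ofFn_succ, List.prod_cons, Matrix.mul_apply, sum_fin_succ_pi,
        Fintype.sum_bool, spectralTransfer_false_false, spectralTransfer_false_true,
        prod_spectralTransfer_true_true, hPe, eval_add, eval_finsetSum, eval_smul, eval_prod,
        eval_mul, eval_sub, eval_one, eval_C, eval_X, smul_eq_mul, mul_add, Finset.mul_sum]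
      congr 1
      · refine Finset.sum_congr rfl fun r _ => ?_
        rw [Finset.prod_congr rfl fun i _ => show 1 - x * u (Fin.succ i) +
          -(1 + (y - x) * u (Fin.succ i)) * v₀ = 1 - x * u (Fin.succ i) - v₀ -
            (y - x) * (u (Fin.succ i) * v₀) by ring]
        ring
      · exact Finset.sum_congr rfl fun r _ => by ring

end Degree

/-! ### The Izergin–Korepin determinant by interpolation. -/

section Polynomials

open Polynomial

/-- The product of the two kinds of weights of an empty vertex. -/
def pairWeight {S : Type*} [CommRing S] (x y u v : S) : S :=
  (1 - u * v) * (1 - x * u - v - (y - x) * (u * v))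

/-- The Izergin–Korepin matrix, with denominators cleared in every column. -/
def izerginMatrix {S : Type*} [CommRing S] (x y : S) {n : ℕ} (u v : Fin n → S) :
    Matrix (Fin n) (Fin n) S :=
  Matrix.of fun i j => ∏ k ∈ Finset.univ.erase i, pairWeight x y (u k) (v j)

/-- The Izergin–Korepin determinant formula for given spectral parameters. -/
def IzerginKorepin {S : Type*} [CommRing S] (x y w wi : S) {n : ℕ} (u v : Fin n → S) : Prop :=
  (Matrix.vandermonde u).det * (Matrix.vandermonde v).det * partitionFn x y w wi u v =
    (∏ i, (1 - w * x * u i)) * (∏ j, (1 - w * v j)) * (izerginMatrix x y u v).det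

theorem det_vandermonde_cons {S : Type*} [CommRing S] {n : ℕ} (a : S) (u : Fin n → S) :
    (Matrix.vandermonde (Fin.cons a u : Fin (n + 1) → S)).det =
      (∏ i, (u i - a)) * (Matrix.vandermonde u).det := by
  rw [Matrix.det_vandermonde, Matrix.det_vandermonde, Fin.prod_univ_succ]
  simp [Fin.prod_Ioi_succ]

theorem erase_zero_univ (n : ℕ) :
    (Finset.univ.erase 0 : Finset (Fin (n + 1))) = Finset.univ.map (Fin.succEmb n) := by
  ext i
  cases i using Fin.cases <;> simp

theorem prod_erase_succ {S : Type*} [CommMonoid S] {n : ℕ} (f : Fin (n + 1) → S) (i : Fin n) :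
    ∏ k ∈ Finset.univ.erase i.succ, f k = f 0 * ∏ k ∈ Finset.univ.erase i, f k.succ := by
  have : (Finset.univ.erase i.succ : Finset (Fin (n + 1))) =
      insert 0 ((Finset.univ.erase i).map (Fin.succEmb n)) := by
    ext k
    cases k using Fin.cases with
    | zero => simp [(Fin.succ_ne_zero i).symm]
    | succ k => simp
  rw [this, Finset.prod_insert (by simp), Finset.prod_map]
  rfl

/-- The minors along the first column of the Izergin–Korepin matrix do not depend on the first
column parameter. -/
theorem det_izerginMatrix_cons {S : Type*} [CommRing S] (x y : S) {n : ℕ} (u : Fin (n + 1) → S)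
    (v₀ : S) (v : Fin n → S) :
    (izerginMatrix x y u (Fin.cons v₀ v : Fin (n + 1) → S)).det =
      ∑ i : Fin (n + 1), (-1) ^ (i : ℕ) *
        (∏ k ∈ Finset.univ.erase i, pairWeight x y (u k) v₀) *
        ((Matrix.of fun (i : Fin (n + 1)) (j : Fin n) =>
          ∏ k ∈ Finset.univ.erase i, pairWeight x y (u k) (v j)).submatrix i.succAbove id).det := by
  rw [Matrix.det_succ_column_zero]
  rfl

/-- At `u₀ * v₀ = 1` both sides obey the same recursion: the partition function freezes, and
`pairWeight` vanishes at the corner, leaving only the top entry in the first column of the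
determinant. -/
theorem izerginKorepin_cons_cons {S : Type*} [CommRing S] (x y w wi : S) {n : ℕ} (u₀ v₀ : S)
    (u v : Fin n → S) (h : u₀ * v₀ = 1) (ih : IzerginKorepin x y w wi u v) :
    IzerginKorepin x y w wi (Fin.cons u₀ u : Fin (n + 1) → S)
      (Fin.cons v₀ v : Fin (n + 1) → S) := by
  unfold IzerginKorepin at ih ⊢
  have hdet : (izerginMatrix x y (Fin.cons u₀ u : Fin (n + 1) → S)
      (Fin.cons v₀ v : Fin (n + 1) → S)).det = (∏ i, pairWeight x y (u i) v₀) *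
        ((∏ j, pairWeight x y u₀ (v j)) * (izerginMatrix x y u v).det) := by
    rw [det_izerginMatrix_cons, Fin.sum_univ_succ, Finset.sum_eq_zero, add_zero, erase_zero_univ,
      Finset.prod_map, ← Matrix.det_mul_row]
    · simp only [Fin.val_zero, pow_zero, one_mul]
      congr 2
      ext i j
      simp only [Matrix.submatrix_apply, Matrix.of_apply, izerginMatrix, Fin.zero_succAbove, id,
        prod_erase_succ, Fin.cons_zero, Fin.cons_succ]
    · intro i _
      rw [prod_erase_succ]
      simp [pairWeight, h]
  -- The new Vandermonde factors cancel the factors `1 - u * v` of `pairWeight`, using `u₀ * v₀ = 1`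
  -- once for each index.
  have hpair : (∏ i, (u i - u₀)) * ∏ j, (v j - v₀) =
      (∏ i, (1 - u i * v₀)) * ∏ j, (1 - u₀ * v j) := by
    rw [← Finset.prod_mul_distrib, ← Finset.prod_mul_distrib]
    exact Finset.prod_congr rfl fun i _ => by linear_combination (1 - u i * v i) * h
  rw [hdet, partitionFn_cons_cons _ _ _ _ _ _ _ _ h, det_vandermonde_cons, det_vandermonde_cons]
  simp only [Fin.prod_univ_succ, Fin.cons_zero, Fin.cons_succ, pairWeight,
    Finset.prod_mul_distrib]
  linear_combination ((1 - w * x * u₀) * (1 - w * v₀) *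
    (∏ j, (1 - x * u₀ - v j - (y - x) * (u₀ * v j))) *
    (∏ i, (1 - x * u i - v₀ - (y - x) * (u i * v₀)))) * ((∏ i, (u i - u₀)) * (∏ j, (v j - v₀)) * ih
    + (∏ i, (1 - w * x * u i)) * (∏ j, (1 - w * v j)) * (izerginMatrix x y u v).det * hpair)

theorem det_izerginMatrix_comp_perm {S : Type*} [CommRing S] (x y : S) {n : ℕ} (u v : Fin n → S)
    (σ : Equiv.Perm (Fin n)) :
    (izerginMatrix x y (u ∘ σ) v).det = Equiv.Perm.sign σ * (izerginMatrix x y u v).det := by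
  rw [← Matrix.det_permute]
  congr 1
  ext i j
  simp only [izerginMatrix, Matrix.submatrix_apply, Matrix.of_apply, id]
  refine Finset.prod_bij (fun k _ => σ k) ?_ ?_ ?_ ?_
  · intro k hk
    simpa using hk
  · intro k _ l _ h
    exact σ.injective h
  · intro k hk
    exact ⟨σ.symm k, by simpa [Equiv.symm_apply_eq] using hk, by simp⟩
  · intro k _
    rfl

/-- The Vandermonde determinant in `u` and the Izergin determinant both change by the sign of `σ`,
while the partition function is symmetric. -/
theorem IzerginKorepin.of_comp_perm {K : Type*} [Field K] (x w : K) (hw : w ≠ 0) {n : ℕ}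
    (u v : Fin n → K)
    (hA : ∀ i j, (1 - w * x * u i) * (1 - w⁻¹ * u j) + (w * x - 1) * (u i - u j) ≠ 0)
    (σ : Equiv.Perm (Fin n))
    (h : IzerginKorepin x (1 + x * (1 - w) - w⁻¹) w w⁻¹ (u ∘ σ) v) :
    IzerginKorepin x (1 + x * (1 - w) - w⁻¹) w w⁻¹ u v := by
  unfold IzerginKorepin at h ⊢
  have hV : (Matrix.vandermonde (u ∘ σ)).det =
      Equiv.Perm.sign σ * (Matrix.vandermonde u).det := by
    rw [← Matrix.det_permute]
    rfl
  rw [partitionFn_comp_perm x w hw u v hA, det_izerginMatrix_comp_perm, hV,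
    show ∏ i, (1 - w * x * (u ∘ σ) i) = ∏ i, (1 - w * x * u i) from
      Equiv.prod_comp σ fun i => 1 - w * x * u i] at h
  have hs : ((Equiv.Perm.sign σ : ℤˣ) : K) * ((Equiv.Perm.sign σ : ℤˣ) : K) = 1 := by
    rcases Int.units_eq_one_or (Equiv.Perm.sign σ) with h | h <;> simp [h]
  linear_combination ((Equiv.Perm.sign σ : ℤˣ) : K) * h +
    ((∏ i, (1 - w * x * u i)) * (∏ j, (1 - w * v j)) * (izerginMatrix x _ u v).det -
      (Matrix.vandermonde u).det * (Matrix.vandermonde v).det *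
        partitionFn x (1 + x * (1 - w) - w⁻¹) w w⁻¹ u v) * hs

/-- The Izergin–Korepin formula at generic spectral parameters. -/
theorem izerginKorepin_of_generic {K : Type*} [Field K] (x w : K) (hw : w ≠ 0) {n : ℕ}
    (u v : Fin n → K) (hu : Function.Injective u) (hv : Function.Injective v)
    (hu0 : ∀ i, u i ≠ 0) (huw : ∀ i, u i ≠ w) (huv : ∀ i j, 1 - u i * v j ≠ 0)
    (hA : ∀ i j, (1 - w * x * u i) * (1 - w⁻¹ * u j) + (w * x - 1) * (u i - u j) ≠ 0) :
    IzerginKorepin x (1 + x * (1 - w) - w⁻¹) w w⁻¹ u v := by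
  induction n with
  | zero =>
    simp [IzerginKorepin, partitionFn,
      Subsingleton.elim (α := Fin 0 → Bool) _ (fun _ => true)]
  | succ n ih =>
    cases v using Fin.consCases with | _ v₀ v =>
    set y := 1 + x * (1 - w) - w⁻¹ with hy
    have hv' : Function.Injective v := fun i j h =>
      Fin.succ_injective _ (hv (by simpa using h))
    obtain ⟨P, hP, hPe⟩ := exists_polynomial_false_true x y w w⁻¹ v u (fun _ => false)
      (fun _ => true)
    have hZ : ∀ v₀, partitionFn x y w w⁻¹ u (Fin.cons v₀ v : Fin (n + 1) → K) =
        (1 - w * v₀) * P.eval v₀ := by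
      intro v₀
      rw [← hPe, ← const_eq_cons, ← const_eq_cons]
      rfl
    -- `F` and `D` are the two sides as polynomials in `v₀`, with the common factor `1 - w * v₀`
    -- removed. Both have degree at most `2 * n`.
    let F : K[X] := ((Matrix.vandermonde u).det * (Matrix.vandermonde v).det) •
      ((∏ j, (C (v j) - X)) * P)
    let D : K[X] := ∑ i : Fin (n + 1), ((∏ i, (1 - w * x * u i)) * (∏ j, (1 - w * v j)) *
        ((-1) ^ (i : ℕ) * ((Matrix.of fun (i : Fin (n + 1)) (j : Fin n) =>
          ∏ k ∈ Finset.univ.erase i, pairWeight x y (u k) (v j)).submatrix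
            i.succAbove id).det)) •
        ∏ k ∈ Finset.univ.erase i, ((1 - C (u k) * X) *
          (C (1 - x * u k) + C (-(1 + (y - x) * u k)) * X))
    have hF : ∀ a, (1 - w * a) * F.eval a = (Matrix.vandermonde u).det *
        (Matrix.vandermonde (Fin.cons a v : Fin (n + 1) → K)).det *
          partitionFn x y w w⁻¹ u (Fin.cons a v : Fin (n + 1) → K) := by
      intro a
      rw [hZ, det_vandermonde_cons]
      simp only [F, eval_smul, eval_mul, eval_prod, eval_sub, eval_C, eval_X, smul_eq_mul]
      ring
    have hD' : ∀ a, D.eval a = (∏ i, (1 - w * x * u i)) * (∏ j, (1 - w * v j)) *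
        (izerginMatrix x y u (Fin.cons a v : Fin (n + 1) → K)).det := by
      intro a
      rw [det_izerginMatrix_cons, Finset.mul_sum]
      simp only [D, eval_finsetSum, eval_smul, eval_prod, smul_eq_mul, eval_mul, eval_add,
        eval_sub, eval_one, eval_C, eval_X]
      refine Finset.sum_congr rfl fun i _ => ?_
      rw [Finset.prod_congr rfl fun k _ => show (1 - u k * a) *
        (1 - x * u k + -(1 + (y - x) * u k) * a) = pairWeight x y (u k) a by
          rw [pairWeight]; ring]
      ring
    have hD : ∀ a, (1 - w * a) * D.eval a = (∏ i, (1 - w * x * u i)) *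
        (∏ j, (1 - w * (Fin.cons a v : Fin (n + 1) → K) j)) *
          (izerginMatrix x y u (Fin.cons a v : Fin (n + 1) → K)).det := by
      intro a
      rw [hD', Fin.prod_univ_succ (fun j => 1 - w * (Fin.cons a v : Fin (n + 1) → K) j)]
      simp only [Fin.cons_zero, Fin.cons_succ]
      ring
    suffices hFD : F = D by
      unfold IzerginKorepin
      rw [← hF, ← hD, hFD]
    have hdegF : F.degree < (Finset.univ : Finset (Fin (n + 1) ⊕ Fin n)).card := by
      rw [← mem_degreeLT]
      refine Submodule.smul_mem _ _ ?_
      have : (Finset.univ : Finset (Fin (n + 1) ⊕ Fin n)).card = n + 1 + n := by simp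
      rw [this]
      refine mul_mem_degreeLT_add ((natDegree_prod_le _ _).trans ?_) hP
      refine (Finset.sum_le_card_nsmul _ _ 1 fun i _ => ?_).trans (by simp)
      compute_degree
    have hdegD : D.degree < (Finset.univ : Finset (Fin (n + 1) ⊕ Fin n)).card := by
      rw [← mem_degreeLT]
      have : (Finset.univ : Finset (Fin (n + 1) ⊕ Fin n)).card = n * 2 + 1 := by
        simp
        ring
      rw [this]
      refine sum_mem fun i _ => Submodule.smul_mem _ _ ?_
      refine mem_degreeLT_succ_of_natDegree_le ((natDegree_prod_le _ _).trans ?_)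
      refine (Finset.sum_le_card_nsmul _ _ 2 fun i _ => ?_).trans (by simp)
      compute_degree
    -- The `2 * n + 1` nodes are the `n + 1` inverses of the `u i` and the `n` remaining column
    -- parameters.
    refine eq_of_degrees_lt_of_eval_index_eq (v := Sum.elim (fun i => (u i)⁻¹) v) _ ?_
      hdegF hdegD ?_
    · rintro (i | i) _ (j | j) _ h
      · exact congrArg _ (hu (inv_injective h))
      · refine absurd ?_ (huv i j.succ)
        simp only [Sum.elim_inl, Sum.elim_inr] at h
        rw [Fin.cons_succ, ← h, mul_inv_cancel₀ (hu0 i), sub_self]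
      · refine absurd ?_ (huv j i.succ)
        simp only [Sum.elim_inl, Sum.elim_inr] at h
        rw [Fin.cons_succ, h, mul_inv_cancel₀ (hu0 j), sub_self]
      · exact congrArg _ (hv' h)
    · rintro (i | j) _
      · have hq : 1 - w * (u i)⁻¹ ≠ 0 := by
          intro h
          apply huw i
          have := hu0 i
          field_simp at h
          linear_combination h
        refine mul_left_cancel₀ hq ?_
        rw [Sum.elim_inl, hF, hD]
        -- By symmetry row `i` moves to the top, where the freezing recursion applies.
        refine IzerginKorepin.of_comp_perm x w hw u _ hA (Equiv.swap 0 i) ?_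
        have hcons : u ∘ Equiv.swap 0 i =
            (Fin.cons (u i) fun k => u (Equiv.swap 0 i k.succ) : Fin (n + 1) → K) := by
          funext k
          cases k using Fin.cases <;> simp
        rw [hcons]
        refine izerginKorepin_cons_cons _ _ _ _ _ _ _ _ (mul_inv_cancel₀ (hu0 i)) ?_
        refine ih _ _ ?_ hv' (fun _ => hu0 _) (fun _ => huw _) (fun k j => ?_) (fun _ _ => hA _ _)
        · intro k l h
          exact Fin.succ_injective _ ((Equiv.swap 0 i).injective (hu h))
        · simpa using huv (Equiv.swap 0 i k.succ) j.succ
      -- Coinciding column parameters kill the Vandermonde factor on one side and give two equal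
      -- columns on the other.
      · have h1 : F.eval (v j) = 0 := by
          simp only [F, eval_smul, eval_mul, eval_prod, eval_sub, eval_C, eval_X, smul_eq_mul]
          rw [Finset.prod_eq_zero (Finset.mem_univ j) (sub_self _)]
          ring
        rw [Sum.elim_inr, h1, hD', Matrix.det_zero_of_column_eq (Fin.succ_ne_zero j).symm, mul_zero]
        intro i
        simp [izerginMatrix]

end Polynomials

/-! ### Base change, from generic parameters to an arbitrary commutative ring. -/

section Map

variable {S S' : Type*} [CommRing S] [CommRing S'] (φ : S →+* S')

theorem map_spectralOp (x y w wi u v : S) (s t : Bool) :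
    φ.mapMatrix (spectralOp x y w wi u v s t) =
      spectralOp (φ x) (φ y) (φ w) (φ wi) (φ u) (φ v) s t := by
  ext a b
  cases s <;> cases t <;> cases a <;> cases b <;> simp [spectralOp, localOp]

theorem map_spectralTransfer (x y w wi : S) {n : ℕ} (v : Fin n → S) (u : S) :
    φ.mapMatrix (spectralTransfer x y w wi v u) =
      spectralTransfer (φ x) (φ y) (φ w) (φ wi) (φ ∘ v) (φ u) := by
  ext s t
  change φ (rowOp _ s t false true) = rowOp _ s t false true
  have h : φ.mapMatrix (rowOp (fun j => spectralOp x y w wi u (v j)) s t) =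
      rowOp (fun j => spectralOp (φ x) (φ y) (φ w) (φ wi) (φ u) (φ (v j))) s t := by
    rw [rowOp, map_list_prod, List.map_ofFn]
    simp only [Function.comp_def, map_spectralOp, rowOp]
  exact congrFun (congrFun h false) true

theorem map_partitionFn (x y w wi : S) {m n : ℕ} (u : Fin m → S) (v : Fin n → S) :
    φ (partitionFn x y w wi u v) =
      partitionFn (φ x) (φ y) (φ w) (φ wi) (φ ∘ u) (φ ∘ v) := by
  have h : φ.mapMatrix (List.ofFn fun i => spectralTransfer x y w wi v (u i)).prod =
      (List.ofFn fun i =>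
        spectralTransfer (φ x) (φ y) (φ w) (φ wi) (φ ∘ v) (φ (u i))).prod := by
    rw [map_list_prod, List.map_ofFn]
    simp only [Function.comp_def, map_spectralTransfer]
  exact congrFun (congrFun h fun _ => false) fun _ => true

theorem map_det_izerginMatrix (x y : S) {n : ℕ} (u v : Fin n → S) :
    φ (izerginMatrix x y u v).det = (izerginMatrix (φ x) (φ y) (φ ∘ u) (φ ∘ v)).det := by
  rw [RingHom.map_det]
  congr 1
  ext i j
  simp [izerginMatrix, pairWeight, map_prod]

theorem map_det_vandermonde {n : ℕ} (u : Fin n → S) :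
    φ (Matrix.vandermonde u).det = (Matrix.vandermonde (φ ∘ u)).det := by
  rw [RingHom.map_det]
  congr 1
  ext i j
  simp [Matrix.vandermonde_apply]

theorem IzerginKorepin.map {x y w wi : S} {n : ℕ} {u v : Fin n → S}
    (h : IzerginKorepin x y w wi u v) :
    IzerginKorepin (φ x) (φ y) (φ w) (φ wi) (φ ∘ u) (φ ∘ v) := by
  have := congrArg φ h
  simpa only [IzerginKorepin, map_mul, map_prod, map_sub, map_one, map_partitionFn,
    map_det_izerginMatrix, map_det_vandermonde, Function.comp_apply] using this

theorem IzerginKorepin.of_map (hφ : Function.Injective φ) {x y w wi : S} {n : ℕ}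
    {u v : Fin n → S} (h : IzerginKorepin (φ x) (φ y) (φ w) (φ wi) (φ ∘ u) (φ ∘ v)) :
    IzerginKorepin x y w wi u v := by
  apply hφ
  simpa only [IzerginKorepin, map_mul, map_prod, map_sub, map_one, map_partitionFn,
    map_det_izerginMatrix, map_det_vandermonde, Function.comp_apply] using h

end Map

/-- The Izergin–Korepin formula for indeterminate spectral parameters. -/
theorem izerginKorepin_X {A : Type*} [CommRing A] [IsDomain A] (x w wi : A) (hw : w * wi = 1)
    (n : ℕ) :
    IzerginKorepin (MvPolynomial.C x) (MvPolynomial.C (1 + x * (1 - w) - wi)) (MvPolynomial.C w)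
      (MvPolynomial.C wi) (fun i : Fin n => (MvPolynomial.X (Sum.inl i) :
        MvPolynomial (Fin n ⊕ Fin n) A)) (fun j => MvPolynomial.X (Sum.inr j)) := by
  let P := MvPolynomial (Fin n ⊕ Fin n) A
  let ψ : P →+* FractionRing P := algebraMap P (FractionRing P)
  have hψ : Function.Injective ψ := IsFractionRing.injective P (FractionRing P)
  -- The last three genericity conditions below each concern a polynomial with constant term `±1` or
  -- `-w`.
  have hne : ∀ p : P, MvPolynomial.constantCoeff p ≠ 0 → ψ p ≠ 0 := by
    intro p hp h
    rw [map_eq_zero_iff ψ hψ] at h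
    simp [h] at hp
  have hw0 : w ≠ 0 := left_ne_zero_of_mul_eq_one hw
  have hw1 : ψ (MvPolynomial.C w) ≠ 0 := hne _ (by simpa using hw0)
  have hw2 : ψ (MvPolynomial.C wi) = (ψ (MvPolynomial.C w))⁻¹ := by
    refine eq_inv_of_mul_eq_one_right ?_
    rw [← map_mul, ← map_mul, hw, map_one, map_one]
  refine IzerginKorepin.of_map ψ hψ ?_
  have hy : ψ (MvPolynomial.C (1 + x * (1 - w) - wi)) = 1 + ψ (MvPolynomial.C x) *
      (1 - ψ (MvPolynomial.C w)) - (ψ (MvPolynomial.C w))⁻¹ := by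
    rw [← hw2]
    simp only [map_add, map_sub, map_mul, map_one]
  rw [hy, hw2]
  refine izerginKorepin_of_generic _ _ hw1 _ _ ?_ ?_ ?_ ?_ ?_ ?_
  · exact hψ.comp ((MvPolynomial.X_injective).comp Sum.inl_injective)
  · exact hψ.comp ((MvPolynomial.X_injective).comp Sum.inr_injective)
  · intro i
    rw [Function.comp_apply, Ne, map_eq_zero_iff ψ hψ]
    exact MvPolynomial.X_ne_zero _
  · intro i h
    refine hne (MvPolynomial.X (Sum.inl i) - MvPolynomial.C w) (by simpa using hw0) ?_
    rw [map_sub, ← h]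
    exact sub_self _
  · intro i j
    have := hne (1 - MvPolynomial.X (Sum.inl i) * MvPolynomial.X (Sum.inr j)) (by simp)
    simpa using this
  · intro i j
    have := hne ((1 - MvPolynomial.C w * MvPolynomial.C x * MvPolynomial.X (Sum.inl i)) *
      (1 - MvPolynomial.C wi * MvPolynomial.X (Sum.inl j)) +
      (MvPolynomial.C w * MvPolynomial.C x - 1) *
        (MvPolynomial.X (Sum.inl i) - MvPolynomial.X (Sum.inl j))) (by simp)
    rw [← hw2]
    simpa using this

/-- The **Izergin–Korepin determinant formula** over an arbitrary commutative ring. -/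
theorem izerginKorepin {R : Type*} [CommRing R] (x w wi : R) (hw : w * wi = 1) {n : ℕ}
    (u v : Fin n → R) : IzerginKorepin x (1 + x * (1 - w) - wi) w wi u v := by
  -- `ℤ[x][w, w⁻¹]` is the universal ring for the data and a domain, so the identity is proved there
  -- and specialised.
  let φ : LaurentPolynomial (Polynomial ℤ) →+* R :=
    LaurentPolynomial.eval₂ (Polynomial.eval₂RingHom (Int.castRingHom R) x)
      ⟨w, wi, hw, by rw [mul_comm, hw]⟩
  have hx : φ (LaurentPolynomial.C Polynomial.X) = x := by
    simp [φ]
  have h1 : φ (LaurentPolynomial.T 1) = w := by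
    simp [φ]
  have h2 : φ (LaurentPolynomial.T (-1)) = wi := by
    simp [φ]
  have h := (izerginKorepin_X (LaurentPolynomial.C Polynomial.X : LaurentPolynomial
    (Polynomial ℤ)) (LaurentPolynomial.T 1) (LaurentPolynomial.T (-1))
    (by rw [← LaurentPolynomial.T_add]; simp) n).map
      (MvPolynomial.eval₂Hom φ (Sum.elim u v))
  simpa [Function.comp_def, hx, h1, h2] using h

/-! ### The generating function of `M`. -/

theorem coeff_genFun {R : Type*} [CommRing R] (A : Matrix ℕ ℕ R) (d : Fin 2 →₀ ℕ) :
    MvPowerSeries.coeff d (genFun A) = A (d 0) (d 1) :=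
  rfl

theorem genFun_one {R : Type*} [CommRing R] :
    genFun (1 : Matrix ℕ ℕ R) = recip (1 - u R * v R) := by
  have huv : u R * v R =
      MvPowerSeries.monomial (Finsupp.single 0 1 + Finsupp.single 1 1) (1 : R) := by
    rw [u, v, MvPowerSeries.X, MvPowerSeries.X, MvPowerSeries.monomial_mul_monomial, one_mul]
  have h : (1 - u R * v R) * genFun (1 : Matrix ℕ ℕ R) = 1 := by
    ext d
    have hle : (Finsupp.single 0 1 + Finsupp.single 1 1 : Fin 2 →₀ ℕ) ≤ d ↔
        1 ≤ d 0 ∧ 1 ≤ d 1 := by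
      simp [Finsupp.le_def, Fin.forall_fin_two]
    have hd : d = 0 ↔ d 0 = 0 ∧ d 1 = 0 := by
      simp [Finsupp.ext_iff, Fin.forall_fin_two]
    rw [sub_mul, one_mul, map_sub, huv, MvPowerSeries.coeff_monomial_mul, MvPowerSeries.coeff_one]
    simp only [hle, hd, coeff_genFun, Matrix.one_apply, Finsupp.coe_tsub, Pi.sub_apply,
      Finsupp.coe_add, Pi.add_apply, Finsupp.single_eq_same, one_mul,
      Finsupp.single_eq_of_ne zero_ne_one, Finsupp.single_eq_of_ne one_ne_zero, add_zero, zero_add]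
    split_ifs <;> first | omega | simp
  calc genFun (1 : Matrix ℕ ℕ R)
      = (1 - u R * v R) * recip (1 - u R * v R) * genFun 1 := by
        rw [mul_recip _ (constantCoeff_one_sub_uv R), one_mul]
    _ = (1 - u R * v R) * genFun 1 * recip (1 - u R * v R) := by ring
    _ = recip (1 - u R * v R) := by rw [h, one_mul]

theorem genFun_G {R : Type*} [CommRing R] (x y : R) : genFun (G x y) = recip (denomG x y) := by
  ext d
  rw [coeff_genFun, G, Matrix.of_apply]
  congr 2
  ext i
  fin_cases i <;> simp

theorem genFun_M {R : Type*} [CommRing R] (x y ν : R) :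
    genFun (M x y ν) = MvPowerSeries.C (1 - ν) * recip (1 - u R * v R) +
      MvPowerSeries.C ν * recip (denomG x y) := by
  rw [← genFun_one, ← genFun_G]
  ext d
  rw [map_add, MvPowerSeries.coeff_C_mul, MvPowerSeries.coeff_C_mul]
  simp [coeff_genFun, M]

/-- On the curve `x ν (1 - ν) = ν + y (1 - ν)` the numerator of the generating function of `M`
factorizes. -/
theorem mul_genFun_M {R : Type*} [CommRing R] (x y ν : R)
    (hν : x * ν * (1 - ν) = ν + y * (1 - ν)) :
    (1 - u R * v R) * denomG x y * genFun (M x y ν) =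
      (1 - MvPowerSeries.C (1 - ν) * MvPowerSeries.C x * u R) *
        (1 - MvPowerSeries.C (1 - ν) * v R) := by
  have h1 := mul_recip _ (constantCoeff_one_sub_uv R)
  have h2 := mul_recip _ (constantCoeff_denomG x y)
  have h3 := congrArg (MvPowerSeries.C (σ := Fin 2)) hν
  rw [genFun_M]
  generalize recip (1 - u R * v R) = a at *
  generalize recip (denomG x y) = b at *
  have h4 : denomG x y = 1 - MvPowerSeries.C x * u R - v R -
    (MvPowerSeries.C y - MvPowerSeries.C x) * (u R * v R) := by rw [denomG, map_sub]
  simp only [map_mul, map_sub, map_add, map_one] at h3 ⊢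
  -- The numerator is `(1 - ν) * denomG + ν * (1 - u v)`. The curve equation turns its `u v`
  -- coefficient into `(1 - ν)² x`, which makes it factor.
  linear_combination denomG x y * (1 - MvPowerSeries.C ν) * h1 +
    (1 - u R * v R) * MvPowerSeries.C ν * h2 + (1 - MvPowerSeries.C ν) * h4 + u R * v R * h3

/-! ### Coefficient extraction and the homogeneous limit. -/

theorem perm_eq_one_of_le {n : ℕ} (σ : Equiv.Perm (Fin n)) (h : ∀ i, i ≤ σ i) : σ = 1 := by
  have hsum : ∑ i, ((i : Fin n) : ℕ) = ∑ i, (σ i : ℕ) :=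
    (Equiv.sum_comp σ fun i => (i : ℕ)).symm
  have := (Finset.sum_eq_sum_iff_of_le fun (i : Fin n) _ => Fin.le_def.1 (h i)).1 hsum
  ext i
  exact (this i (Finset.mem_univ i)).symm

/-- Extracting the leading coefficient of a Vandermonde determinant. -/
theorem coeff_det_vandermonde_mul {R τ : Type*} [CommRing R] {n : ℕ} (e : Fin n ↪ τ)
    (q : τ →₀ ℕ) (hq : ∀ k, q (e k) = 0) (H : MvPowerSeries τ R) :
    MvPowerSeries.coeff (∑ i, Finsupp.single (e i) (i : ℕ) + q)
        ((Matrix.vandermonde fun i => (MvPowerSeries.X (e i) : MvPowerSeries τ R)).det * H) =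
      MvPowerSeries.coeff q H := by
  classical
  have hmon : ∀ σ : Equiv.Perm (Fin n),
      ∏ i, Matrix.vandermonde (fun i => (MvPowerSeries.X (e i) : MvPowerSeries τ R)) (σ i) i =
        MvPowerSeries.monomial (∑ i, Finsupp.single (e (σ i)) (i : ℕ)) 1 := by
    intro σ
    simp only [Matrix.vandermonde_apply, MvPowerSeries.X_pow_eq]
    rw [MvPowerSeries.prod_monomial]
    simp
  have heval : ∀ (σ : Equiv.Perm (Fin n)) (k : Fin n),
      (∑ i, Finsupp.single (e (σ i)) (i : ℕ)) (e (σ k)) = k := by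
    intro σ k
    rw [Finsupp.finsetSum_apply, Finset.sum_eq_single k]
    · simp
    · intro i _ hik
      rw [Finsupp.single_apply_eq_zero]
      intro h
      exact absurd (σ.injective (e.injective h)).symm hik
    · simp
  rw [Matrix.det_apply, Finset.sum_mul, map_sum, Finset.sum_eq_single 1]
  · rw [hmon]
    simp [MvPowerSeries.coeff_add_monomial_mul]
  · intro σ _ hσ
    rw [hmon, smul_mul_assoc, Units.smul_def, map_zsmul, MvPowerSeries.coeff_monomial_mul, if_neg,
      smul_zero]
    intro hle
    -- The monomial of `σ` has exponent `i` at the variable `e (σ i)`, where the target exponent is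
    -- `σ i`. Divisibility therefore forces `i ≤ σ i` for all `i`.
    refine hσ (perm_eq_one_of_le σ fun i => ?_)
    have h := hle (e (σ i))
    rw [heval, Finsupp.add_apply, hq, add_zero] at h
    have h1 := heval 1 (σ i)
    simp only [Equiv.Perm.one_apply] at h1
    exact h.trans_eq h1
  · simp

theorem mem_range_of_coeff_rename_ne_zero {R τ : Type*} [CommRing R] {a b : τ}
    {f : MvPowerSeries (Fin 2) R} {d : τ →₀ ℕ}
    (h : MvPowerSeries.coeff d (MvPowerSeries.rename ![a, b] f) ≠ 0) {c : τ} (hca : c ≠ a)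
    (hcb : c ≠ b) : d c = 0 := by
  have hd : d ∈ Set.range (Finsupp.mapDomain ![a, b]) := by
    by_contra h'
    exact h (MvPowerSeries.coeff_rename_eq_zero _ _ h')
  obtain ⟨d, rfl⟩ := hd
  refine Finsupp.mapDomain_of_notMem_range _ _ ?_
  rintro ⟨i, hi⟩
  fin_cases i
  · exact hca hi.symm
  · exact hcb hi.symm

theorem coeff_rename_genFun {R τ : Type*} [CommRing R] {a b : τ} (hab : a ≠ b)
    (A : Matrix ℕ ℕ R) (k l : ℕ) :
    MvPowerSeries.coeff (Finsupp.single a k + Finsupp.single b l)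
      (MvPowerSeries.rename ![a, b] (genFun A)) = A k l := by
  have hinj : Function.Injective ![a, b] := by
    intro i j h
    fin_cases i <;> fin_cases j <;> simp_all
  have h := MvPowerSeries.coeff_embDomain_rename (⟨![a, b], hinj⟩ : Fin 2 ↪ τ) (genFun A)
    (Finsupp.single 0 k + Finsupp.single 1 l)
  rw [coeff_genFun, Finsupp.embDomain_add, Finsupp.embDomain_single, Finsupp.embDomain_single] at h
  simpa using h

/-- The monomial `∏ u_i ^ i * ∏ v_j ^ j`. -/
noncomputable def staircase (n : ℕ) : Fin n ⊕ Fin n →₀ ℕ :=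
  ∑ i : Fin n, Finsupp.single (Sum.inl i) (i : ℕ) +
    ∑ j : Fin n, Finsupp.single (Sum.inr j) (j : ℕ)

theorem staircase_inl {n : ℕ} (i : Fin n) : staircase n (Sum.inl i) = i := by
  simp [staircase, Finsupp.single_apply]

theorem staircase_inr {n : ℕ} (i : Fin n) : staircase n (Sum.inr i) = i := by
  simp [staircase, Finsupp.single_apply]

/-- Each variable occurs in exactly one factor, so only one distribution of the exponents
contributes. -/
theorem coeff_staircase_prod {R : Type*} [CommRing R] {n : ℕ} (A : Matrix ℕ ℕ R)
    (σ : Equiv.Perm (Fin n)) :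
    MvPowerSeries.coeff (staircase n)
      (∏ i, MvPowerSeries.rename ![Sum.inl (σ i), Sum.inr i] (genFun A)) =
      ∏ i, A (σ i) (i : ℕ) := by
  classical
  rw [MvPowerSeries.coeff_prod, Finset.sum_eq_single (Finsupp.equivFunOnFinite.symm fun i =>
    Finsupp.single (Sum.inl (σ i)) (σ i : ℕ) + Finsupp.single (Sum.inr i) (i : ℕ))]
  · refine Finset.prod_congr rfl fun i _ => ?_
    rw [Finsupp.equivFunOnFinite_symm_apply_apply]
    exact coeff_rename_genFun (by simp) A _ _
  · intro l hl hne
    by_contra hprod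
    refine hne (Finsupp.ext fun i => Finsupp.ext fun c => ?_)
    have hsupp : ∀ (k : Fin n) (c : Fin n ⊕ Fin n), c ≠ Sum.inl (σ k) → c ≠ Sum.inr k →
        l k c = 0 := fun k c h1 h2 =>
      mem_range_of_coeff_rename_ne_zero
        (fun h0 => hprod (Finset.prod_eq_zero (Finset.mem_univ k) h0)) h1 h2
    rw [Finset.mem_finsuppAntidiag] at hl
    have hsum : ∀ c, ∑ k, l k c = staircase n c := by
      intro c
      rw [← hl.1, Finsupp.finsetSum_apply]
    rw [Finsupp.equivFunOnFinite_symm_apply_apply, Finsupp.add_apply]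
    rcases c with c | c
    · by_cases hc : c = σ i
      · subst hc
        have h := hsum (Sum.inl (σ i))
        rw [Finset.sum_eq_single i, staircase_inl] at h
        · simpa using h
        · intro k _ hk
          exact hsupp k _ (by simpa using hk.symm) (by simp)
        · simp
      · rw [hsupp i _ (by simpa using hc) (by simp)]
        simp [Ne.symm hc]
    · by_cases hc : c = i
      · subst hc
        have h := hsum (Sum.inr c)
        rw [Finset.sum_eq_single c, staircase_inr] at h
        · simpa using h
        · intro k _ hk
          exact hsupp k _ (by simp) (by simpa using hk.symm)
        · simp
      · rw [hsupp i _ (by simp) (by simpa using hc)]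
        simp [Ne.symm hc]
  · intro h
    refine absurd ?_ h
    rw [Finset.mem_finsuppAntidiag]
    refine ⟨?_, Finset.subset_univ _⟩
    simp only [Finsupp.equivFunOnFinite_symm_apply_apply, Finset.sum_add_distrib, staircase]
    rw [Equiv.sum_comp σ fun i => Finsupp.single (Sum.inl i : Fin n ⊕ Fin n) (i : ℕ)]

theorem coeff_staircase_vandermonde {R : Type*} [CommRing R] {n : ℕ}
    (H : MvPowerSeries (Fin n ⊕ Fin n) R) :
    MvPowerSeries.coeff (staircase n)
      ((Matrix.vandermonde fun i => (MvPowerSeries.X (Sum.inl i) :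
          MvPowerSeries (Fin n ⊕ Fin n) R)).det *
        ((Matrix.vandermonde fun j => (MvPowerSeries.X (Sum.inr j) :
          MvPowerSeries (Fin n ⊕ Fin n) R)).det * H)) = MvPowerSeries.constantCoeff H := by
  rw [staircase]
  refine (coeff_det_vandermonde_mul Function.Embedding.inl _ ?_ _).trans ?_
  · intro k
    simp [Finsupp.finsetSum_apply]
  · have h := coeff_det_vandermonde_mul (R := R)
      (Function.Embedding.inr : Fin n ↪ Fin n ⊕ Fin n) 0 (by simp) H
    rw [add_zero] at h
    exact h

/-- The homogeneous limit of the Izergin–Korepin formula. -/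
theorem partitionFn_zero_eq_det {R : Type*} [CommRing R] (x y ν : R)
    (hν : x * ν * (1 - ν) = ν + y * (1 - ν)) (n : ℕ) :
    partitionFn x y (1 - ν) (1 + x * ν - y) (fun _ : Fin n => (0 : R)) (fun _ : Fin n => 0) =
      (truncate n (M x y ν)).det := by
  set w := 1 - ν with hw
  set wi := 1 + x * ν - y with hw'
  have hww : w * wi = 1 := by
    rw [hw, hw']
    linear_combination hν
  have hy : y = 1 + x * (1 - w) - wi := by
    rw [hw, hw']
    ring
  let S := MvPowerSeries (Fin n ⊕ Fin n) R
  let c : R →+* S := MvPowerSeries.C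
  let U : Fin n → S := fun i => MvPowerSeries.X (Sum.inl i)
  let V : Fin n → S := fun i => MvPowerSeries.X (Sum.inr i)
  let F : Matrix (Fin n) (Fin n) S := Matrix.of fun i j =>
    MvPowerSeries.rename ![Sum.inl i, Sum.inr j] (genFun (M x y ν))
  have hIK : IzerginKorepin (c x) (c y) (c w) (c wi) U V := by
    have h := izerginKorepin (c x) (c w) (c wi) (by rw [← map_mul, hww, map_one]) U V
    rwa [show 1 + c x * (1 - c w) - c wi = c y by
      rw [hy]; simp only [map_add, map_sub, map_mul, map_one]] at h
  have hF : ∀ i j, pairWeight (c x) (c y) (U i) (V j) * F i j =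
      (1 - c w * c x * U i) * (1 - c w * V j) := by
    intro i j
    have h := congrArg (MvPowerSeries.rename ![(Sum.inl i : Fin n ⊕ Fin n), Sum.inr j])
      (mul_genFun_M x y ν hν)
    simpa [denomG, u, v, pairWeight, c, U, V, F, hw] using h
  let N : S := ∏ j, ∏ k, pairWeight (c x) (c y) (U k) (V j)
  have hN : MvPowerSeries.constantCoeff N = 1 := by
    simp [N, pairWeight, U, V, c, map_prod]
  have hdet : N * F.det = (∏ i, (1 - c w * c x * U i)) * (∏ j, (1 - c w * V j)) *
      (izerginMatrix (c x) (c y) U V).det := by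
    rw [mul_assoc, ← Matrix.det_mul_row, ← Matrix.det_mul_row, ← Matrix.det_mul_column]
    congr 1
    ext1 i j
    simp only [Matrix.of_apply, izerginMatrix]
    rw [← Finset.mul_prod_erase _ _ (Finset.mem_univ i), mul_right_comm, hF]
    ring
  obtain ⟨Q, hQ⟩ : ∃ Q, N * Q = 1 :=
    (MvPowerSeries.isUnit_iff_constantCoeff.2 (by rw [hN]; exact isUnit_one)).exists_right_inv
  have hQ1 : MvPowerSeries.constantCoeff Q = 1 := by
    have := congrArg MvPowerSeries.constantCoeff hQ
    simpa [hN] using this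
  -- The Vandermonde determinants stay as factors: reading off a coefficient replaces dividing by
  -- them and passing to the limit.
  have key : F.det = (Matrix.vandermonde U).det * ((Matrix.vandermonde V).det *
      (partitionFn (c x) (c y) (c w) (c wi) U V * Q)) := by
    unfold IzerginKorepin at hIK
    linear_combination (-F.det) * hQ + Q * hdet - Q * hIK
  have hcoeff := congrArg (MvPowerSeries.coeff (staircase n)) key
  rw [coeff_staircase_vandermonde, map_mul, hQ1, mul_one, map_partitionFn] at hcoeff
  have hc : ∀ r, MvPowerSeries.constantCoeff (c r) = r := MvPowerSeries.constantCoeff_C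
  rw [hc, hc, hc, hc] at hcoeff
  have h0 : partitionFn x y w wi (fun _ : Fin n => (0 : R)) (fun _ : Fin n => 0) =
      partitionFn x y w wi (MvPowerSeries.constantCoeff ∘ U)
        (MvPowerSeries.constantCoeff ∘ V) := by
    congr 1 <;> funext i <;> simp [U, V]
  rw [h0, ← hcoeff, Matrix.det_apply, Matrix.det_apply, map_sum]
  refine Finset.sum_congr rfl fun σ _ => ?_
  rw [Units.smul_def, Units.smul_def, map_zsmul]
  congr 1
  exact coeff_staircase_prod (M x y ν) σ

/-! ### Alternating sign matrices as six-vertex configurations. -/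

/-- The weight of an entry `b` of an alternating sign matrix, where `c` and `r` are the sums of
the entries above it and to its left. It is zero if a partial sum is not `0` or `1`. -/
def vertexWeight {R : Type*} [CommRing R] (x y : R) (c r b : ℤ) : R :=
  if (c = 0 ∨ c = 1) ∧ (r = 0 ∨ r = 1) ∧ (c + b = 0 ∨ c + b = 1) ∧ (r + b = 0 ∨ r + b = 1) then
    y ^ (c * r - if b = -1 then 1 else 0).toNat * x ^ (if b = -1 then 1 else 0)
  else 0

theorem localOp_eq_vertexWeight {R : Type*} [CommRing R] (x y : R) (s t a b : Bool) :
    localOp 1 y 1 1 x s t a b = if a.toInt + (t.toInt - s.toInt) = b.toInt then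
      vertexWeight x y s.toInt a.toInt (t.toInt - s.toInt) else 0 := by
  cases s <;> cases t <;> cases a <;> cases b <;> simp [localOp, vertexWeight]

theorem sum_Iio_succ {A : Type*} [AddCommMonoid A] {n : ℕ} (f : Fin (n + 1) → A) (j : Fin n) :
    ∑ k ∈ Finset.Iio j.succ, f k = f 0 + ∑ k ∈ Finset.Iio j, f k.succ := by
  have : Finset.Iio j.succ = insert 0 ((Finset.Iio j).map (Fin.succEmb n)) := by
    ext k
    cases k using Fin.cases <;> simp
  rw [this, Finset.sum_insert (by simp), Finset.sum_map]
  rfl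

theorem sum_Iio_zero {A : Type*} [AddCommMonoid A] {n : ℕ} (f : Fin (n + 1) → A) :
    ∑ k ∈ Finset.Iio 0, f k = 0 :=
  Finset.sum_eq_zero fun k hk => absurd (Finset.mem_Iio.1 hk) (Fin.not_lt_zero k)

theorem sum_Iic_eq {A : Type*} [AddCommMonoid A] {n : ℕ} (f : Fin n → A) (j : Fin n) :
    ∑ k ∈ Finset.Iic j, f k = ∑ k ∈ Finset.Iio j, f k + f j := by
  rw [← Finset.Iio_insert, Finset.sum_insert (by simp), add_comm]

/-- Conservation at each vertex determines the horizontal states as partial row sums, so at most one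
path through the row survives. -/
theorem rowOp_eq_prod_vertexWeight {R : Type*} [CommRing R] (x y : R) {n : ℕ}
    (s t : Fin n → Bool) (a b : Bool) :
    rowOp (fun _ => localOp 1 y 1 1 x) s t a b =
      if a.toInt + ∑ j, ((t j).toInt - (s j).toInt) = b.toInt then
        ∏ j, vertexWeight x y (s j).toInt
          (a.toInt + ∑ k ∈ Finset.Iio j, ((t k).toInt - (s k).toInt))
          ((t j).toInt - (s j).toInt)
      else 0 := by
  induction n generalizing a with
  | zero => cases a <;> cases b <;> simp [rowOp]
  | succ n ih =>
    cases s using Fin.consCases with | _ s₀ s =>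
    cases t using Fin.consCases with | _ t₀ t =>
    rw [rowOp_cons, Matrix.mul_apply]
    simp only [ih, localOp_eq_vertexWeight, Fin.sum_univ_succ, Fin.prod_univ_succ, Fin.cons_zero,
      Fin.cons_succ, sum_Iio_succ]
    by_cases h : ∃ c : Bool, a.toInt + (t₀.toInt - s₀.toInt) = c.toInt
    · obtain ⟨c, hc⟩ := h
      rw [Finset.sum_eq_single c]
      · simp only [← add_assoc, hc, if_true, mul_ite, mul_zero, sum_Iio_zero, add_zero]
      · intro d _ hd
        rw [if_neg, zero_mul]
        rw [hc]
        intro h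
        cases c <;> cases d <;> simp_all
      · simp
    · have hw : vertexWeight x y s₀.toInt a.toInt (t₀.toInt - s₀.toInt) = 0 := by
        refine if_neg fun hv => h ?_
        rcases hv.2.2.2 with h0 | h1
        · exact ⟨false, h0⟩
        · exact ⟨true, h1⟩
      simp [hw, sum_Iio_zero]

/-- Path expansion of a matrix power: `p i` is the state after step `i`, and prepending `s` supplies
the state before it. -/
theorem prod_replicate_apply {R α : Type*} [CommRing R] [Fintype α] [DecidableEq α]
    (T : Matrix α α R) (m : ℕ) (s t : α) :
    (List.ofFn fun _ : Fin m => T).prod s t = ∑ p : Fin m → α,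
      if (Fin.cons s p : Fin (m + 1) → α) (Fin.last m) = t then
        ∏ i, T ((Fin.cons s p : Fin (m + 1) → α) i.castSucc) (p i) else 0 := by
  induction m generalizing s with
  | zero => simp [Matrix.one_apply]
  | succ m ih =>
    rw [List.ofFn_succ, List.prod_cons, Matrix.mul_apply,
      ← Fintype.sum_equiv (Fin.consEquiv fun _ : Fin (m + 1) => α)
        (fun q => if (Fin.cons s (Fin.cons q.1 q.2 : Fin (m + 1) → α) : Fin (m + 2) → α)
          (Fin.last (m + 1)) = t then ∏ i, T ((Fin.cons s (Fin.cons q.1 q.2 : Fin (m + 1) → α) :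
            Fin (m + 2) → α) i.castSucc) ((Fin.cons q.1 q.2 : Fin (m + 1) → α) i) else 0)
        _ fun _ => rfl, Fintype.sum_prod_type]
    refine Finset.sum_congr rfl fun r _ => ?_
    rw [ih, Finset.mul_sum]
    refine Finset.sum_congr rfl fun p _ => ?_
    rw [← Fin.succ_last, Fin.cons_succ, Fin.prod_univ_succ, mul_ite, mul_zero]
    rfl

theorem sum_Iic_sub {m : ℕ} (g : Fin (m + 1) → ℤ) (i : Fin m) :
    ∑ k ∈ Finset.Iic i, (g k.succ - g k.castSucc) = g i.succ - g 0 := by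
  induction m with
  | zero => exact i.elim0
  | succ m ih =>
    cases i using Fin.cases with
    | zero => simp [sum_Iic_eq, sum_Iio_zero]
    | succ i =>
      have h := ih (fun k => g k.succ) i
      rw [sum_Iic_eq] at h
      rw [sum_Iic_eq, sum_Iio_succ]
      simp only [Fin.castSucc_zero, ← Fin.succ_castSucc] at h ⊢
      have h2 : g (Fin.succ 0) = g 1 := rfl
      linarith

theorem sum_Iio_sub {m : ℕ} (g : Fin (m + 1) → ℤ) (i : Fin m) :
    ∑ k ∈ Finset.Iio i, (g k.succ - g k.castSucc) = g i.castSucc - g 0 := by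
  have h := sum_Iic_sub g i
  rw [sum_Iic_eq] at h
  linarith

theorem sum_univ_sub {m : ℕ} (g : Fin (m + 1) → ℤ) :
    ∑ k : Fin m, (g k.succ - g k.castSucc) = g (Fin.last m) - g 0 := by
  rw [Finset.sum_sub_distrib]
  have h1 := Fin.sum_univ_succ g
  have h2 := Fin.sum_univ_castSucc g
  linarith

/-- Grouping the inversions by the cell below one entry and to the right of the other makes the
statistic a sum of local contributions. -/
theorem inv_eq_sum {n : ℕ} (B : Matrix (Fin n) (Fin n) ℤ) :
    inv B = ∑ i, ∑ j, (∑ k ∈ Finset.Iio i, B k j) * (∑ k ∈ Finset.Iio j, B i k) := by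
  unfold inv
  rw [Finset.sum_comm' (t' := Finset.univ) (s' := fun j => Finset.Iio j) (by simp)]
  refine Finset.sum_congr rfl fun j _ => ?_
  simp only [Finset.sum_mul_sum]
  exact (Finset.sum_congr rfl fun i _ => Finset.sum_comm' (by simp)).trans Finset.sum_comm

theorem numNeg_eq_sum {n : ℕ} (B : Matrix (Fin n) (Fin n) ℤ) :
    numNeg B = ∑ i, ∑ j, if B i j = -1 then 1 else 0 := by
  rw [← Fintype.sum_prod_type' (f := fun i j => if B i j = -1 then 1 else 0)]
  simp [numNeg]

theorem sum_Iio_mem {n : ℕ} (f : Fin n → ℤ)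
    (h : ∀ k, 0 ≤ ∑ i ∈ Finset.Iic k, f i ∧ ∑ i ∈ Finset.Iic k, f i ≤ 1) (a : Fin n) :
    ∑ i ∈ Finset.Iio a, f i = 0 ∨ ∑ i ∈ Finset.Iio a, f i = 1 := by
  obtain ⟨a, ha⟩ := a
  cases a with
  | zero =>
    left
    refine Finset.sum_eq_zero fun i hi => ?_
    simp [Fin.lt_def] at hi
  | succ b =>
    have : Finset.Iio (⟨b + 1, ha⟩ : Fin n) = Finset.Iic ⟨b, by omega⟩ := by
      ext i
      simp [Fin.lt_def, Fin.le_def]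
    rw [this]
    have := h ⟨b, by omega⟩
    omega

open Classical in
/-- The product of the vertex weights of a matrix whose row and column sums are `1`. -/
noncomputable def matrixWeight {R : Type*} [CommRing R] (x y : R) {n : ℕ}
    (B : Matrix (Fin n) (Fin n) ℤ) : R :=
  if (∀ j, ∑ i, B i j = 1) ∧ ∀ i, ∑ j, B i j = 1 then
    ∏ i, ∏ j, vertexWeight x y (∑ k ∈ Finset.Iio i, B k j) (∑ k ∈ Finset.Iio j, B i k) (B i j)
  else 0

theorem isASM_of_matrixWeight_ne_zero {R : Type*} [CommRing R] (x y : R) {n : ℕ}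
    (B : Matrix (Fin n) (Fin n) ℤ) (h : matrixWeight x y B ≠ 0) : IsASM B := by
  unfold matrixWeight at h
  split_ifs at h with hs
  · have hv : ∀ i j, vertexWeight x y (∑ k ∈ Finset.Iio i, B k j) (∑ k ∈ Finset.Iio j, B i k)
        (B i j) ≠ 0 := fun i j h0 =>
      h (Finset.prod_eq_zero (Finset.mem_univ i) (Finset.prod_eq_zero (Finset.mem_univ j) h0))
    have hv' : ∀ i j, _ := fun i j => of_not_not fun hn => hv i j (if_neg hn)
    refine ⟨fun i j => ?_, hs.2, hs.1, fun i k => ?_, fun j k => ?_⟩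
    · have := hv' i j
      omega
    · have := hv' i k
      rw [sum_Iic_eq]
      omega
    · have := hv' k j
      rw [sum_Iic_eq]
      omega
  · exact absurd rfl h

theorem matrixWeight_of_isASM {R : Type*} [CommRing R] (x y : R) {n : ℕ}
    (B : Matrix (Fin n) (Fin n) ℤ) (hB : IsASM B) :
    matrixWeight x y B = y ^ (inv B - numNeg B).toNat * x ^ numNeg B := by
  have hc : ∀ i j, (∑ k ∈ Finset.Iio i, B k j = 0 ∨ ∑ k ∈ Finset.Iio i, B k j = 1) ∧
      (∑ k ∈ Finset.Iio j, B i k = 0 ∨ ∑ k ∈ Finset.Iio j, B i k = 1) ∧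
      (∑ k ∈ Finset.Iio i, B k j + B i j = 0 ∨ ∑ k ∈ Finset.Iio i, B k j + B i j = 1) ∧
      (∑ k ∈ Finset.Iio j, B i k + B i j = 0 ∨ ∑ k ∈ Finset.Iio j, B i k + B i j = 1) := by
    intro i j
    refine ⟨sum_Iio_mem _ (hB.col_partial j) i, sum_Iio_mem _ (hB.row_partial i) j, ?_, ?_⟩
    · have := hB.col_partial j i
      rw [sum_Iic_eq] at this
      omega
    · have := hB.row_partial i j
      rw [sum_Iic_eq] at this
      omega
  -- At an entry `-1` both partial sums before it equal 1, so no local exponent is negative and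
  -- `toNat` commutes with the sum.
  have hexp : inv B - numNeg B = ((∑ i, ∑ j, ((∑ k ∈ Finset.Iio i, B k j) *
      (∑ k ∈ Finset.Iio j, B i k) - if B i j = -1 then 1 else 0).toNat : ℕ) : ℤ) := by
    rw [inv_eq_sum, numNeg_eq_sum]
    simp only [Nat.cast_sum, Nat.cast_ite, Nat.cast_one, Nat.cast_zero]
    rw [← Finset.sum_sub_distrib]
    refine Finset.sum_congr rfl fun i _ => ?_
    rw [← Finset.sum_sub_distrib]
    refine Finset.sum_congr rfl fun j _ => ?_
    rw [Int.toNat_of_nonneg]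
    obtain ⟨h1, h2, h3, h4⟩ := hc i j
    generalize ∑ k ∈ Finset.Iio i, B k j = c at *
    generalize ∑ k ∈ Finset.Iio j, B i k = r at *
    rcases h1 with rfl | rfl <;> rcases h2 with rfl | rfl <;> split_ifs <;> omega
  rw [hexp, Int.toNat_natCast, numNeg_eq_sum, matrixWeight, if_pos ⟨hB.col_sum, hB.row_sum⟩]
  simp only [← Finset.prod_pow_eq_pow_sum, ← Finset.prod_mul_distrib]
  exact Finset.prod_congr rfl fun i _ => Finset.prod_congr rfl fun j _ => if_pos (hc i j)

/-- The matrix of differences of consecutive states of the vertical edges. -/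
def diffMatrix {n : ℕ} (p : Fin n → Fin n → Bool) : Matrix (Fin n) (Fin n) ℤ :=
  Matrix.of fun i j => (p i j).toInt -
    ((Fin.cons (fun _ => false) p : Fin (n + 1) → Fin n → Bool) i.castSucc j).toInt

theorem sum_Iic_diffMatrix {n : ℕ} (p : Fin n → Fin n → Bool) (i j : Fin n) :
    ∑ k ∈ Finset.Iic i, diffMatrix p k j = (p i j).toInt := by
  have h := sum_Iic_sub (fun k =>
    ((Fin.cons (fun _ => false) p : Fin (n + 1) → Fin n → Bool) k j).toInt) i
  simpa [diffMatrix] using h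

theorem sum_Iio_diffMatrix {n : ℕ} (p : Fin n → Fin n → Bool) (i j : Fin n) :
    ∑ k ∈ Finset.Iio i, diffMatrix p k j =
      ((Fin.cons (fun _ => false) p : Fin (n + 1) → Fin n → Bool) i.castSucc j).toInt := by
  have h := sum_Iio_sub (fun k =>
    ((Fin.cons (fun _ => false) p : Fin (n + 1) → Fin n → Bool) k j).toInt) i
  simpa [diffMatrix] using h

theorem sum_diffMatrix {n : ℕ} (p : Fin n → Fin n → Bool) (j : Fin n) :
    ∑ k, diffMatrix p k j =
      ((Fin.cons (fun _ => false) p : Fin (n + 1) → Fin n → Bool) (Fin.last n) j).toInt := by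
  have h := sum_univ_sub (fun k =>
    ((Fin.cons (fun _ => false) p : Fin (n + 1) → Fin n → Bool) k j).toInt)
  simpa [diffMatrix] using h

theorem eq_of_sum_Iic_eq {n : ℕ} (f g : Fin n → ℤ)
    (h : ∀ i, ∑ k ∈ Finset.Iic i, f k = ∑ k ∈ Finset.Iic i, g k) : f = g := by
  funext i
  induction i using WellFoundedLT.induction with
  | _ i ih =>
    have := h i
    rwa [sum_Iic_eq, sum_Iic_eq, Finset.sum_congr rfl fun k hk => ih k (Finset.mem_Iio.1 hk),
      add_right_inj] at this

/-- The transfer matrix sum at vanishing spectral parameters enumerates alternating sign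
matrices. -/
theorem Z_eq_partitionFn {R : Type*} [CommRing R] (x y w wi : R) (n : ℕ) :
    Z n x y 1 = partitionFn x y w wi (fun _ : Fin n => (0 : R)) (fun _ : Fin n => 0) := by
  have hop : spectralOp x y w wi 0 0 = localOp 1 y 1 1 x := by
    simp [spectralOp]
  have hp : ∀ p : Fin n → Fin n → Bool,
      (if (Fin.cons (fun _ => false) p : Fin (n + 1) → Fin n → Bool) (Fin.last n) =
          fun _ => true then
        ∏ i, transfer (fun _ => localOp 1 y 1 1 x)
          ((Fin.cons (fun _ => false) p : Fin (n + 1) → Fin n → Bool) i.castSucc) (p i)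
        else 0) = matrixWeight x y (diffMatrix p) := by
    intro p
    have hlast : (Fin.cons (fun _ => false) p : Fin (n + 1) → Fin n → Bool) (Fin.last n) =
        (fun _ => true) ↔ ∀ j, ∑ i, diffMatrix p i j = 1 := by
      rw [funext_iff]
      refine forall_congr' fun j => ?_
      rw [sum_diffMatrix]
      cases (Fin.cons (fun _ => false) p : Fin (n + 1) → Fin n → Bool) (Fin.last n) j <;> simp
    have hrow : ∀ i, transfer (fun _ => localOp 1 y 1 1 x)
        ((Fin.cons (fun _ => false) p : Fin (n + 1) → Fin n → Bool) i.castSucc) (p i) =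
        if ∑ j, diffMatrix p i j = 1 then ∏ j, vertexWeight x y
          (∑ k ∈ Finset.Iio i, diffMatrix p k j) (∑ k ∈ Finset.Iio j, diffMatrix p i k)
            (diffMatrix p i j) else 0 := by
      intro i
      rw [transfer, Matrix.of_apply, rowOp_eq_prod_vertexWeight]
      simp only [sum_Iio_diffMatrix, Bool.toInt_false, Bool.toInt_true, zero_add]
      rfl
    simp only [hrow, hlast, matrixWeight, Finset.prod_ite_zero, Finset.mem_univ, true_imp_iff,
      ← ite_and]
  have hZ : Z n x y 1 = ∑ B ∈ asmFinset n, matrixWeight x y B := by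
    refine Finset.sum_congr rfl fun B hB => ?_
    rw [matrixWeight_of_isASM x y B ((mem_asmFinset B).1 hB), one_pow, one_mul]
  rw [hZ, partitionFn]
  simp only [spectralTransfer, hop]
  rw [prod_replicate_apply]
  simp only [hp]
  let e : Matrix (Fin n) (Fin n) ℤ → Fin n → Fin n → Bool := fun B i j =>
    decide (∑ k ∈ Finset.Iic i, B k j = 1)
  have he : ∀ B, IsASM B → diffMatrix (e B) = B := by
    intro B hB
    have hcol : ∀ j, (fun i => diffMatrix (e B) i j) = fun i => B i j := by
      intro j
      refine eq_of_sum_Iic_eq _ _ fun i => ?_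
      rw [sum_Iic_diffMatrix]
      have := hB.col_partial j i
      by_cases h : ∑ k ∈ Finset.Iic i, B k j = 1
      · simp [e, h]
      · simp only [e, h, decide_false, Bool.toInt_false]
        omega
    ext i j
    exact congrFun (hcol j) i
  -- Edge configurations outside the image of the alternating sign matrices have weight 0.
  refine Finset.sum_of_injOn e ?_ (fun _ _ => Finset.mem_coe.2 (Finset.mem_univ _)) ?_ ?_
  · intro B hB B' hB' h
    rw [← he B ((mem_asmFinset B).1 hB), ← he B' ((mem_asmFinset B').1 hB'), h]
  · intro p _ hpe
    by_contra hne
    refine hpe ⟨diffMatrix p, (mem_asmFinset _).2 (isASM_of_matrixWeight_ne_zero x y _ hne), ?_⟩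
    funext i j
    simp only [e, sum_Iic_diffMatrix]
    cases p i j <;> simp
  · intro B hB
    rw [he B ((mem_asmFinset B).1 hB)]

end ASM

theorem mainTheorem2 {R : Type*} [CommRing R] (x y ν : R)
    (hν : x * ν * (1 - ν) = ν + y * (1 - ν)) :
    ASM.genFun (ASM.M x y ν) =
        MvPowerSeries.C (1 - ν) * ASM.recip (1 - ASM.u R * ASM.v R) +
          MvPowerSeries.C ν * ASM.recip
            (1 - MvPowerSeries.C x * ASM.u R - ASM.v R -
              MvPowerSeries.C (y - x) * (ASM.u R * ASM.v R)) ∧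
      ∀ n : ℕ, ASM.Z n x y 1 = (ASM.truncate n (ASM.M x y ν)).det :=
  -- At zero spectral parameters `w` and its inverse drop out of the weights, so they may be chosen
  -- to suit the determinant formula.
  ⟨ASM.genFun_M x y ν, fun n =>
    (ASM.Z_eq_partitionFn x y _ _ n).trans (ASM.partitionFn_zero_eq_det x y ν hν n)⟩
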